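/- **Theorem (maximum load of the parallel 2-choice process).** Consider $n$ bins, all initially empty, and $n$ generators, and let $\lambda\in[0,1]$ be the arrival rate. Time proceeds in synchronous rounds $1,2,\dots$. At the start of a round every non-empty bin deletes one of its balls. Afterward each of the $n$ generators, independently of all others and of the past, generates a ball with probability $\lambda$. Each generated ball queries two bins chosen independently and uniformly at random (with replacement) and is placed into a least loaded one of the two (Greedy[2]). All balls of a round are allocated in parallel: the loads they compare are those right after the deletions of that round, and they do not see each other. Ties may be broken by any fixed rule that depends only on the configuration at the beginning of the round and on the ordered pair of queried bins. Let $M(t)$ denote the maximum number of balls in a bin at the end of round $t$ (with $M(0)=0$). There are absolute constants $C>0$, $c>0$ and $n_0\in\mathbb{N}$ such that for all integers $n\ge\max(n_0,1)$, all $\lambda\in[1/4,1)$ (so $\lambda$ may depend on $n$), every such tie-breaking rule and every round $t\in\mathbb{N}$, however large, $$\Pr\Bigl[M(t)\le C\cdot\log\frac{n}{1-\lambda}\Bigr]\;\ge\;1-n^{-c}.$$ That is, for any fixed round $t$ the maximum load is $O\bigl(\log\frac{n}{1-\lambda}\bigr)$ with high probability. -/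

import Mathlib

open MeasureTheory ProbabilityTheory

namespace TwoChoice

/-- A configuration: the number of balls in each of the `n` (labelled) bins. -/
abbrev Config (n : ℕ) := Fin n → ℕ

/-- The random bits of one generator in one round: whether it generates a ball, and the two bins
(possibly equal) that this ball queries. The two bins are ignored if no ball is generated. -/
abbrev Draw (n : ℕ) := Bool × Fin n × Fin n

/-- The random bits of one round: one draw for each of the `n` generators. -/
abbrev RoundDraws (n : ℕ) := Fin n → Draw n

/-- The loads right after the deletion phase that starts a round: every non-empty bin has
deleted one ball (the subtraction of natural numbers leaves empty bins empty). -/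
def afterDeletion {n : ℕ} (x : Config n) : Config n := fun i => x i - 1

/-- An allocation rule gets the configuration `x` at the beginning of the round and the two queried
bins `a`, `b` (in the order in which they were drawn) and returns the bin that receives the ball. -/
abbrev AllocRule (n : ℕ) := Config n → Fin n → Fin n → Fin n

/-- The rule is a version of Greedy[2]: the ball goes to a least loaded one of the two queried bins,
loads being those after the deletion phase. How ties are broken is left to the rule. -/
def IsGreedyTwo {n : ℕ} (rule : AllocRule n) : Prop :=
  ∀ (x : Config n) (a b : Fin n),
    (rule x a b = a ∧ afterDeletion x a ≤ afterDeletion x b) ∨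
    (rule x a b = b ∧ afterDeletion x b ≤ afterDeletion x a)

/-- The number of balls that bin `i` receives in a round with draws `r` that begins in the
configuration `x`. All balls of the round are allocated in parallel, on the basis of `x` alone. -/
def arrivals {n : ℕ} (rule : AllocRule n) (x : Config n) (r : RoundDraws n) (i : Fin n) : ℕ :=
  (Finset.univ.filter
    (fun g : Fin n => (r g).1 = true ∧ rule x (r g).2.1 (r g).2.2 = i)).card

/-- One round: first the deletions, then the arrivals. -/
def step {n : ℕ} (rule : AllocRule n) (x : Config n) (r : RoundDraws n) : Config n :=
  fun i => afterDeletion x i + arrivals rule x r i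

/-- `load rule ω t` is the configuration at the end of round `t`, starting from the empty system;
`ω t` are the draws of round `t + 1`. -/
def load {n : ℕ} (rule : AllocRule n) (ω : ℕ → RoundDraws n) : ℕ → Config n
  | 0 => fun _ => 0
  | t + 1 => step rule (load rule ω t) (ω t)

/-- The maximum load of all bins. -/
def maxLoad {n : ℕ} (x : Config n) : ℕ := Finset.univ.sup x

/-- The law of the draw of one generator in one round: a ball is generated with probability `lam`,
and, independently, the two queried bins are independent and uniform. -/
noncomputable def drawLaw (n : ℕ) (lam : unitInterval) : Measure (Draw n) :=
  (bernoulliMeasure true false lam).prod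
    ((uniformOn (Set.univ : Set (Fin n))).prod (uniformOn (Set.univ : Set (Fin n))))

/-- The law of all draws: independent over all rounds and all generators. -/
noncomputable def processLaw (n : ℕ) (lam : unitInterval) : Measure (ℕ → RoundDraws n) :=
  Measure.infinitePi (fun _ : ℕ => Measure.pi (fun _ : Fin n => drawLaw n lam))

instance drawLaw_isProbabilityMeasure (n : ℕ) [NeZero n] (lam : unitInterval) :
    IsProbabilityMeasure (drawLaw n lam) := by
  have : IsProbabilityMeasure (uniformOn (Set.univ : Set (Fin n))) :=
    isProbabilityMeasure_uniformOn Set.finite_univ Set.univ_nonempty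
  unfold drawLaw
  infer_instance

instance processLaw_isProbabilityMeasure (n : ℕ) [NeZero n] (lam : unitInterval) :
    IsProbabilityMeasure (processLaw n lam) := by
  unfold processLaw
  infer_instance

end TwoChoice

/-!
For small `α > 0`, the load differences and the mean load are controlled by two exponential
potentials, `Φ = ∑ i, ∑ j, exp (α * (x i - x j))` and `W = exp (α * mean load)`.

Against uniform allocation, Greedy[2] biases the balls towards bins with small weights
`u i = exp (α * x i)`, and the bias is exactly the Gini coefficient of `u`; likewise towards large
`(u i)⁻¹`. As `Φ = (∑ i, u i) * ∑ i, (u i)⁻¹`, in each round `Φ` is multiplied in expectation by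
about `exp (-lam * α * G)`, where `G` is the sum of both coefficients. If `G` is bounded away from
`0`, this is a contraction; if `G` is small, then `Φ` is of order `n ^ 2`. Hence `E Φ ≤ 2 * n ^ 2`
at all times, uniformly in `lam`.

While no bin is empty, the mean load has drift `-(1 - lam)`, so that `W` contracts; when some bin
is empty, the mean load is at most a load difference and `W ≤ Φ`. Hence `E W` is of order
`n ^ 2 / (1 - lam)`. Since `exp (α * maximum load) ≤ Φ * W`, Markov's inequality for `√(Φ * W)`
gives the exponential tail.
-/

namespace TwoChoice

section RandomRecursion

variable {E R : Type*}

/-- The trajectory of the recursion `X (t + 1) = f (X t) (ω t)` started from `X 0 = x₀`, as a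
function of the noise `ω`. The process of the theorem is of this form, and its law is studied
through the one-step drift of `f`. -/
def trajectory (f : E → R → E) (x₀ : E) (ω : ℕ → R) : ℕ → E
  | 0 => x₀
  | t + 1 => f (trajectory f x₀ ω t) (ω t)

lemma dependsOn_trajectory (f : E → R → E) (x₀ : E) (t : ℕ) :
    DependsOn (fun ω => trajectory f x₀ ω t) (Finset.range t : Set ℕ) := by
  intro ω ω' h
  induction t with
  | zero => rfl
  | succ t ih =>
    simp only [Finset.coe_range, Set.mem_Iio] at h ih
    simp only [trajectory, ih fun s hs => h s (by omega), h t t.lt_succ_self]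

lemma exists_trajectory_eq_restrict (f : E → R → E) (x₀ : E) (t : ℕ) :
    ∃ g : (Finset.range t → R) → E, ∀ ω, trajectory f x₀ ω t = g ((Finset.range t).restrict ω) := by
  have : Nonempty E := ⟨x₀⟩
  obtain ⟨g, hg⟩ := dependsOn_iff_exists_comp.1 (dependsOn_trajectory f x₀ t)
  exact ⟨g, congrFun hg⟩

variable [MeasurableSpace R] (μ : Measure R) [IsProbabilityMeasure μ]

lemma map_restrict_range_prodMk_eval (t : ℕ) :
    (Measure.infinitePi fun _ : ℕ => μ).map (fun ω => ((Finset.range t).restrict ω, ω t)) =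
      (Measure.pi fun _ : Finset.range t => μ).prod μ := by
  have hind : iIndepFun (fun (s : ℕ) (ω : ℕ → R) => ω s) (Measure.infinitePi fun _ => μ) :=
    iIndepFun_infinitePi (P := fun _ => μ) (X := fun _ r => r) fun _ => measurable_id
  have hpast := (hind.indepFun_finset (Finset.range t) {t} (by simp) measurable_pi_apply).comp
    measurable_id (measurable_pi_apply ⟨t, Finset.mem_singleton_self t⟩)
  refine ((indepFun_iff_map_prod_eq_prod_map_map (Finset.measurable_restrict _).aemeasurable
    (measurable_pi_apply t).aemeasurable).1 hpast).trans ?_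
  congr 1
  · exact Measure.infinitePi_map_restrict _
  · exact Measure.infinitePi_map_eval _ t

variable [Finite R] [MeasurableSingletonClass R] (f : E → R → E) (x₀ : E)

lemma integrable_comp_trajectory (V : E → ℝ) (t : ℕ) :
    Integrable (fun ω => V (trajectory f x₀ ω t)) (Measure.infinitePi fun _ : ℕ => μ) := by
  obtain ⟨g, hg⟩ := exists_trajectory_eq_restrict f x₀ t
  simp only [hg]
  exact (Integrable.of_finite (f := V ∘ g)).comp_measurable (Finset.measurable_restrict _)

lemma integral_comp_trajectory_succ (V : E → ℝ) (t : ℕ) :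
    ∫ ω, V (trajectory f x₀ ω (t + 1)) ∂(Measure.infinitePi fun _ => μ) =
      ∫ ω, ∫ r, V (f (trajectory f x₀ ω t) r) ∂μ ∂(Measure.infinitePi fun _ => μ) := by
  obtain ⟨g, hg⟩ := exists_trajectory_eq_restrict f x₀ t
  have hpair : Measurable fun ω : ℕ → R => ((Finset.range t).restrict ω, ω t) :=
    (Finset.measurable_restrict _).prodMk (measurable_pi_apply t)
  let W (p : (Finset.range t → R) × R) : ℝ := V (f (g p.1) p.2)
  simp only [trajectory, hg]
  calc ∫ ω, W ((Finset.range t).restrict ω, ω t) ∂(Measure.infinitePi fun _ => μ)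
      = ∫ p, W p ∂((Measure.pi fun _ => μ).prod μ) := by
        rw [← map_restrict_range_prodMk_eval,
          integral_map hpair.aemeasurable (measurable_of_countable W).aestronglyMeasurable]
    _ = ∫ ω, ∫ r, W ((Finset.range t).restrict ω, r) ∂μ ∂(Measure.infinitePi fun _ => μ) := by
        rw [integral_prod _ Integrable.of_finite, ← Measure.infinitePi_map_restrict (fun _ => μ),
          integral_map (Finset.measurable_restrict _).aemeasurable
            (measurable_of_countable _).aestronglyMeasurable]

lemma integral_comp_trajectory_le_of_drift {V U : E → ℝ} {a u B : ℝ} (ha : 0 ≤ a)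
    (hdrift : ∀ x, ∫ r, V (f x r) ∂μ ≤ a * V x + U x)
    (hU : ∀ t, ∫ ω, U (trajectory f x₀ ω t) ∂(Measure.infinitePi fun _ => μ) ≤ u)
    (hzero : V x₀ ≤ B) (hfix : a * B + u ≤ B) (t : ℕ) :
    ∫ ω, V (trajectory f x₀ ω t) ∂(Measure.infinitePi fun _ => μ) ≤ B := by
  have hint (F : E → ℝ) (t : ℕ) := integrable_comp_trajectory μ f x₀ F t
  induction t with
  | zero => simpa [trajectory] using hzero
  | succ t ih =>
    calc ∫ ω, V (trajectory f x₀ ω (t + 1)) ∂(Measure.infinitePi fun _ => μ)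
        = ∫ ω, ∫ r, V (f (trajectory f x₀ ω t) r) ∂μ ∂(Measure.infinitePi fun _ => μ) :=
          integral_comp_trajectory_succ μ f x₀ V t
      _ ≤ ∫ ω, (a * V (trajectory f x₀ ω t) + U (trajectory f x₀ ω t))
            ∂(Measure.infinitePi fun _ => μ) :=
          integral_mono (hint (fun x => ∫ r, V (f x r) ∂μ) t)
            (((hint V t).const_mul a).add (hint U t)) fun ω => hdrift _
      _ = a * ∫ ω, V (trajectory f x₀ ω t) ∂(Measure.infinitePi fun _ => μ) +
            ∫ ω, U (trajectory f x₀ ω t) ∂(Measure.infinitePi fun _ => μ) := by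
          rw [integral_add ((hint V t).const_mul a) (hint U t), integral_const_mul]
      _ ≤ a * B + u := by gcongr; exact hU t
      _ ≤ B := hfix

end RandomRecursion

section Gini

variable {ι : Type*} [Fintype ι]

/-- The Gini coefficient of the family `u`: the mean distance of two of its members, divided by
twice their mean. It lies between `0` and `1` for positive `u`. -/
noncomputable def gini (u : ι → ℝ) : ℝ :=
  (∑ a, ∑ b, |u a - u b|) / (2 * Fintype.card ι * ∑ i, u i)

lemma gini_nonneg {u : ι → ℝ} (hu : ∀ i, 0 ≤ u i) : 0 ≤ gini u :=
  div_nonneg (Finset.sum_nonneg fun _ _ => Finset.sum_nonneg fun _ _ => abs_nonneg _)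
    (mul_nonneg (by positivity) (Finset.sum_nonneg fun i _ => hu i))

lemma sum_sum_add (u : ι → ℝ) :
    ∑ a, ∑ b, (u a + u b) = 2 * Fintype.card ι * ∑ i, u i := by
  simp only [Finset.sum_add_distrib, Finset.sum_const, Finset.card_univ, nsmul_eq_mul,
    ← Finset.mul_sum]
  ring

lemma gini_le_one {u : ι → ℝ} (hu : ∀ i, 0 ≤ u i) : gini u ≤ 1 := by
  refine div_le_one_of_le₀ ?_ (mul_nonneg (by positivity) (Finset.sum_nonneg fun i _ => hu i))
  rw [← sum_sum_add]
  gcongr with a _ b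
  exact abs_sub_le_iff.2 ⟨by linarith [hu b], by linarith [hu a]⟩

lemma sum_sum_abs_sub {u : ι → ℝ} (hu : ∑ i, u i ≠ 0) :
    ∑ a, ∑ b, |u a - u b| = 2 * Fintype.card ι * (∑ i, u i) * gini u := by
  have hι : (Fintype.card ι : ℝ) ≠ 0 := by
    obtain ⟨i, -, -⟩ := Finset.exists_ne_zero_of_sum_ne_zero hu
    have : Nonempty ι := ⟨i⟩
    exact Nat.cast_ne_zero.2 Fintype.card_ne_zero
  rw [gini, mul_div_cancel₀ _ (by positivity)]

lemma sum_sum_min {u : ι → ℝ} (hu : ∑ i, u i ≠ 0) :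
    ∑ a, ∑ b, min (u a) (u b) = Fintype.card ι * ((∑ i, u i) * (1 - gini u)) := by
  have hmin (a b : ι) : min (u a) (u b) = 1 / 2 * (u a + u b) - 1 / 2 * |u a - u b| := by
    linarith [min_add_max (u a) (u b), max_sub_min_eq_abs' (u a) (u b)]
  simp only [hmin, Finset.sum_sub_distrib, ← Finset.mul_sum, sum_sum_add, sum_sum_abs_sub hu]
  ring

lemma sum_sum_max {u : ι → ℝ} (hu : ∑ i, u i ≠ 0) :
    ∑ a, ∑ b, max (u a) (u b) = Fintype.card ι * ((∑ i, u i) * (1 + gini u)) := by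
  have hmax (a b : ι) : max (u a) (u b) = u a + u b - min (u a) (u b) := by
    linarith [min_add_max (u a) (u b)]
  simp only [hmax, Finset.sum_sub_distrib, sum_sum_add, sum_sum_min hu]
  ring

lemma sum_le_card_mul_add_sum_abs_sub (u : ι → ℝ) (a : ι) :
    ∑ b, u b ≤ Fintype.card ι * u a + ∑ b, |u a - u b| := by
  calc ∑ b, u b ≤ ∑ b, (u a + |u a - u b|) := by
        gcongr with b
        linarith [neg_abs_le (u a - u b)]
    _ = Fintype.card ι * u a + ∑ b, |u a - u b| := by simp [Finset.sum_add_distrib]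

/-- By averaging, some `u a` and `(u a)⁻¹` are both close to the respective means: their relative
deviations add up to at most `2 * (gini u + gini u⁻¹)`. -/
lemma one_sub_gini_mul_sum_mul_sum_inv_le {u : ι → ℝ} (hu : ∀ i, 0 < u i) :
    (1 - 2 * (gini u + gini u⁻¹)) * ((∑ i, u i) * ∑ i, u⁻¹ i) ≤ (Fintype.card ι : ℝ) ^ 2 := by
  rcases isEmpty_or_nonempty ι with hι | hι
  · simp
  have hinv : ∀ i, 0 < u⁻¹ i := fun i => inv_pos.2 (hu i)
  have hP : 0 < ∑ i, u i := Finset.sum_pos (fun i _ => hu i) Finset.univ_nonempty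
  have hQ : 0 < ∑ i, u⁻¹ i := Finset.sum_pos (fun i _ => hinv i) Finset.univ_nonempty
  obtain ⟨a, -, ha⟩ : ∃ a ∈ Finset.univ,
      (∑ b, |u a - u b|) / ∑ i, u i + (∑ b, |u⁻¹ a - u⁻¹ b|) / ∑ i, u⁻¹ i ≤
        2 * (gini u + gini u⁻¹) := by
    refine Finset.exists_le_of_sum_le Finset.univ_nonempty (le_of_eq ?_)
    rw [Finset.sum_add_distrib, ← Finset.sum_div, ← Finset.sum_div, sum_sum_abs_sub hP.ne',
      sum_sum_abs_sub hQ.ne', Finset.sum_const, Finset.card_univ, nsmul_eq_mul]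
    field_simp
  set δ := (∑ b, |u a - u b|) / ∑ i, u i
  set ε := (∑ b, |u⁻¹ a - u⁻¹ b|) / ∑ i, u⁻¹ i
  have hδ : 0 ≤ δ := by positivity
  have hε : 0 ≤ ε := by positivity
  have hua : (1 - δ) * ∑ i, u i ≤ Fintype.card ι * u a := by
    rw [sub_mul, div_mul_cancel₀ _ hP.ne']
    linarith [sum_le_card_mul_add_sum_abs_sub u a]
  have hva : (1 - ε) * ∑ i, u⁻¹ i ≤ Fintype.card ι * u⁻¹ a := by
    rw [sub_mul, div_mul_cancel₀ _ hQ.ne']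
    linarith [sum_le_card_mul_add_sum_abs_sub u⁻¹ a]
  rcases le_or_gt (1 - 2 * (gini u + gini u⁻¹)) 0 with hG | hG
  · exact (mul_nonpos_of_nonpos_of_nonneg hG (by positivity)).trans (by positivity)
  calc (1 - 2 * (gini u + gini u⁻¹)) * ((∑ i, u i) * ∑ i, u⁻¹ i)
      ≤ ((1 - δ) * (1 - ε)) * ((∑ i, u i) * ∑ i, u⁻¹ i) := by
        gcongr
        nlinarith
    _ = ((1 - δ) * ∑ i, u i) * ((1 - ε) * ∑ i, u⁻¹ i) := by ring
    _ ≤ (Fintype.card ι * u a) * (Fintype.card ι * u⁻¹ a) :=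
        mul_le_mul hua hva (mul_nonneg (by linarith) hQ.le)
          (mul_nonneg (Nat.cast_nonneg _) (hu a).le)
    _ = (Fintype.card ι : ℝ) ^ 2 := by
        rw [Pi.inv_apply]
        field_simp [(hu a).ne']

end Gini

section Laws

lemma integral_uniformOn_univ {ι : Type*} [Fintype ι] [MeasurableSpace ι]
    [MeasurableSingletonClass ι] (f : ι → ℝ) :
    ∫ i, f i ∂(uniformOn Set.univ) = (∑ i, f i) / Fintype.card ι := by
  rw [integral_fintype Integrable.of_finite, Finset.sum_div]
  refine Finset.sum_congr rfl fun i _ => ?_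
  simp [measureReal_def, uniformOn_univ, div_eq_inv_mul]

variable (n : ℕ) [NeZero n] (lam : unitInterval)

lemma integral_drawLaw (f : Draw n → ℝ) :
    ∫ d, f d ∂(drawLaw n lam) =
      lam * ((∑ a, ∑ b, f (true, a, b)) / n ^ 2) +
        (1 - lam) * ((∑ a, ∑ b, f (false, a, b)) / n ^ 2) := by
  have : IsProbabilityMeasure (uniformOn (Set.univ : Set (Fin n))) :=
    isProbabilityMeasure_uniformOn Set.finite_univ Set.univ_nonempty
  have hpair (c : Bool) : ∫ q, f (c, q) ∂((uniformOn Set.univ).prod (uniformOn Set.univ)) =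
      (∑ a, ∑ b, f (c, a, b)) / n ^ 2 := by
    rw [integral_prod _ Integrable.of_finite]
    simp only [integral_uniformOn_univ, ← Finset.sum_div, div_div, Fintype.card_fin, pow_two]
  rw [drawLaw, integral_prod _ Integrable.of_finite]
  simp [integral_bernoulliMeasure, hpair]

/-- The law of the draws of one round. -/
noncomputable def roundLaw (n : ℕ) (lam : unitInterval) : Measure (RoundDraws n) :=
  Measure.pi fun _ => drawLaw n lam

instance roundLaw_isProbabilityMeasure : IsProbabilityMeasure (roundLaw n lam) := by
  unfold roundLaw
  infer_instance

lemma integral_roundLaw_prod (f : Draw n → ℝ) :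
    ∫ r, ∏ g, f (r g) ∂(roundLaw n lam) = (∫ d, f d ∂(drawLaw n lam)) ^ n := by
  rw [roundLaw, integral_fintype_prod_eq_pow, Fintype.card_fin]

end Laws

variable {n : ℕ}

lemma load_eq_trajectory (rule : AllocRule n) (ω : ℕ → RoundDraws n) (t : ℕ) :
    load rule ω t = trajectory (step rule) (fun _ => 0) ω t := by
  induction t with
  | zero => rfl
  | succ t ih => rw [load, trajectory, ih]

lemma integrable_comp_load [NeZero n] (rule : AllocRule n) (lam : unitInterval)
    (V : Config n → ℝ) (t : ℕ) :
    Integrable (fun ω => V (load rule ω t)) (processLaw n lam) := by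
  simp only [load_eq_trajectory]
  exact integrable_comp_trajectory (roundLaw n lam) (step rule) (fun _ => 0) V t

section Allocation

variable (rule : AllocRule n) (x : Config n)

/-- The number of balls, `0` or `1`, that bin `i` receives from a generator with draw `d` in a round
that begins in the configuration `x`. -/
def hit (d : Draw n) (i : Fin n) : ℝ := if d.1 = true ∧ rule x d.2.1 d.2.2 = i then 1 else 0

/-- `n` times the probability that a generated ball is placed into bin `i`, in a round that begins
in the configuration `x`; under uniform single-choice allocation it would be `1`. -/
noncomputable def share (i : Fin n) : ℝ := (∑ a, ∑ b, if rule x a b = i then 1 else 0) / n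

lemma step_apply (r : RoundDraws n) (i : Fin n) :
    (step rule x r i : ℝ) = afterDeletion x i + ∑ g, hit rule x (r g) i := by
  simp [step, arrivals, hit]

lemma share_nonneg (i : Fin n) : 0 ≤ share rule x i := by
  unfold share
  positivity

lemma sum_mul_share (f : Fin n → ℝ) :
    ∑ i, f i * share rule x i = (∑ a, ∑ b, f (rule x a b)) / n := by
  have hf (a b : Fin n) : f (rule x a b) = ∑ i, f i * if rule x a b = i then 1 else 0 := by simp
  simp only [hf, share, mul_div_assoc', ← Finset.sum_div, Finset.mul_sum]
  rw [← Finset.sum_comm_cycle]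

lemma integral_hit [NeZero n] (lam : unitInterval) (i : Fin n) :
    ∫ d, hit rule x d i ∂(drawLaw n lam) = lam * share rule x i / n := by
  rw [integral_drawLaw]
  simp only [hit, share, true_and, Bool.false_eq_true, false_and, if_false, Finset.sum_const_zero]
  ring

lemma exp_mul_hit_sub_hit_le (α : ℝ) (d : Draw n) (i j : Fin n) :
    Real.exp (α * (hit rule x d i - hit rule x d j)) ≤
      1 + (Real.exp α - 1) * hit rule x d i + (Real.exp (-α) - 1) * hit rule x d j := by
  have hcosh : 1 ≤ (Real.exp α + Real.exp (-α)) / 2 := Real.cosh_eq α ▸ Real.one_le_cosh α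
  simp only [hit]
  split_ifs <;>
    simp only [sub_self, sub_zero, zero_sub, mul_zero, mul_one, mul_neg, Real.exp_zero] <;>
    linarith

lemma integral_exp_mul_hit_sub_hit_pow_le [NeZero n] (α : ℝ) (lam : unitInterval)
    (i j : Fin n) :
    (∫ d, Real.exp (α * (hit rule x d i - hit rule x d j)) ∂(drawLaw n lam)) ^ n ≤
      Real.exp (lam * (Real.exp α - 1) * share rule x i) *
        Real.exp (lam * (Real.exp (-α) - 1) * share rule x j) := by
  have hn : (n : ℝ) ≠ 0 := Nat.cast_ne_zero.2 (NeZero.ne n)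
  set z : ℝ := (lam * (Real.exp α - 1) * share rule x i +
    lam * (Real.exp (-α) - 1) * share rule x j) / n with hz
  have hle : ∫ d, Real.exp (α * (hit rule x d i - hit rule x d j)) ∂(drawLaw n lam) ≤ z + 1 := by
    calc ∫ d, Real.exp (α * (hit rule x d i - hit rule x d j)) ∂(drawLaw n lam)
        ≤ ∫ d, (1 + (Real.exp α - 1) * hit rule x d i + (Real.exp (-α) - 1) * hit rule x d j)
            ∂(drawLaw n lam) :=
          integral_mono .of_finite .of_finite fun d => exp_mul_hit_sub_hit_le rule x α d i j
      _ = z + 1 := by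
          rw [integral_add .of_finite .of_finite, integral_add .of_finite .of_finite,
            integral_const_mul, integral_const_mul, integral_hit, integral_hit]
          simp only [integral_const, probReal_univ, smul_eq_mul, mul_one]
          ring
  calc (∫ d, Real.exp (α * (hit rule x d i - hit rule x d j)) ∂(drawLaw n lam)) ^ n
      ≤ Real.exp z ^ n :=
        pow_le_pow_left₀ (integral_nonneg fun d => (Real.exp_pos _).le)
          (hle.trans (Real.add_one_le_exp z)) n
    _ = Real.exp (lam * (Real.exp α - 1) * share rule x i) *
          Real.exp (lam * (Real.exp (-α) - 1) * share rule x j) := by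
        rw [← Real.exp_nat_mul, ← Real.exp_add, hz, mul_div_cancel₀ _ hn]

variable {rule}

lemma IsGreedyTwo.eq_or_eq (hrule : IsGreedyTwo rule) (a b : Fin n) :
    rule x a b = a ∨ rule x a b = b :=
  (hrule x a b).imp And.left And.left

lemma IsGreedyTwo.afterDeletion_rule (hrule : IsGreedyTwo rule) (a b : Fin n) :
    afterDeletion x (rule x a b) = min (afterDeletion x a) (afterDeletion x b) := by
  rcases hrule x a b with ⟨h, hle⟩ | ⟨h, hle⟩ <;> simp [h, hle]

lemma IsGreedyTwo.share_le_two [NeZero n] (hrule : IsGreedyTwo rule) (i : Fin n) :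
    share rule x i ≤ 2 := by
  have hn : (0 : ℝ) < n := Nat.cast_pos.2 (NeZero.pos n)
  rw [share, div_le_iff₀ hn]
  calc ∑ a, ∑ b, (if rule x a b = i then (1 : ℝ) else 0)
      ≤ ∑ a, ∑ b, ((if a = i then 1 else 0) + if b = i then 1 else 0) := by
        gcongr with a _ b
        rcases hrule.eq_or_eq x a b with h | h <;> rw [h] <;> split_ifs <;> norm_num
    _ = 2 * n := by
        simp only [Finset.sum_add_distrib, Finset.sum_const, Finset.card_univ, Fintype.card_fin,
          nsmul_eq_mul, ← Finset.mul_sum, Finset.sum_ite_eq', Finset.mem_univ, if_true]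
        ring

end Allocation

section Weight

variable (α : ℝ) (x : Config n)

/-- The exponential weights of the loads. -/
noncomputable def weight (α : ℝ) (x : Config n) (i : Fin n) : ℝ := Real.exp (α * x i)

lemma weight_pos (i : Fin n) : 0 < weight α x i := Real.exp_pos _

lemma sum_weight_pos [NeZero n] : 0 < ∑ i, weight α x i :=
  Finset.sum_pos (fun i _ => weight_pos α x i) Finset.univ_nonempty

lemma weight_neg : weight (-α) x = (weight α x)⁻¹ := by
  ext i
  simp [weight, Real.exp_neg]

lemma weight_mul_weight_neg (i j : Fin n) :
    weight α x i * weight (-α) x j = Real.exp (α * ((x i : ℝ) - x j)) := by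
  rw [weight, weight, ← Real.exp_add]
  ring_nf

variable {α} {rule : AllocRule n}

/-- Greedy[2] sends the balls to bins of small weight: the total weight of the chosen bins falls
below its value under uniform allocation by the Gini coefficient. -/
lemma IsGreedyTwo.sum_weight_mul_share_of_nonneg [NeZero n] (hrule : IsGreedyTwo rule)
    (hα : 0 ≤ α) :
    ∑ i, weight α (afterDeletion x) i * share rule x i =
      (∑ i, weight α (afterDeletion x) i) * (1 - gini (weight α (afterDeletion x))) := by
  have hmono : Monotone fun k : ℕ => Real.exp (α * k) := fun k l hkl =>
    Real.exp_le_exp.2 (mul_le_mul_of_nonneg_left (Nat.cast_le.2 hkl) hα)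
  have hmin (a b : Fin n) : weight α (afterDeletion x) (rule x a b) =
      min (weight α (afterDeletion x) a) (weight α (afterDeletion x) b) := by
    simp only [weight, hrule.afterDeletion_rule, hmono.map_min]
  simp only [sum_mul_share, hmin, sum_sum_min (sum_weight_pos α _).ne', Fintype.card_fin]
  rw [mul_div_cancel_left₀ _ (Nat.cast_ne_zero.2 (NeZero.ne n))]

lemma IsGreedyTwo.sum_weight_mul_share_of_nonpos [NeZero n] (hrule : IsGreedyTwo rule)
    (hα : α ≤ 0) :
    ∑ i, weight α (afterDeletion x) i * share rule x i =
      (∑ i, weight α (afterDeletion x) i) * (1 + gini (weight α (afterDeletion x))) := by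
  have hanti : Antitone fun k : ℕ => Real.exp (α * k) := fun k l hkl =>
    Real.exp_le_exp.2 (mul_le_mul_of_nonpos_left (Nat.cast_le.2 hkl) hα)
  have hmax (a b : Fin n) : weight α (afterDeletion x) (rule x a b) =
      max (weight α (afterDeletion x) a) (weight α (afterDeletion x) b) := by
    simp only [weight, hrule.afterDeletion_rule, hanti.map_min]
  simp only [sum_mul_share, hmax, sum_sum_max (sum_weight_pos α _).ne', Fintype.card_fin]
  rw [mul_div_cancel_left₀ _ (Nat.cast_ne_zero.2 (NeZero.ne n))]

end Weight

section GapPotential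

/-- The potential that controls the differences of the loads. -/
noncomputable def gapPotential (α : ℝ) (x : Config n) : ℝ :=
  ∑ i, ∑ j, Real.exp (α * ((x i : ℝ) - x j))

variable (α : ℝ) (x : Config n)

lemma gapPotential_nonneg : 0 ≤ gapPotential α x := by
  unfold gapPotential
  positivity

lemma gapPotential_zero : gapPotential α (fun _ : Fin n => 0) = n ^ 2 := by
  simp [gapPotential, pow_two]

lemma exp_mul_sub_le_gapPotential (i j : Fin n) :
    Real.exp (α * ((x i : ℝ) - x j)) ≤ gapPotential α x := by
  have hpos (i j : Fin n) : 0 ≤ Real.exp (α * ((x i : ℝ) - x j)) := (Real.exp_pos _).le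
  calc Real.exp (α * ((x i : ℝ) - x j))
      ≤ ∑ j, Real.exp (α * ((x i : ℝ) - x j)) :=
        Finset.single_le_sum (fun j _ => hpos i j) (Finset.mem_univ j)
    _ ≤ gapPotential α x :=
        Finset.single_le_sum (f := fun i => ∑ j, Real.exp (α * ((x i : ℝ) - x j)))
          (fun i _ => Finset.sum_nonneg fun j _ => hpos i j) (Finset.mem_univ i)

lemma gapPotential_eq_sum_weight_mul_sum_weight_neg :
    gapPotential α x = (∑ i, weight α x i) * ∑ j, weight (-α) x j := by
  simp only [gapPotential, Finset.sum_mul_sum, weight_mul_weight_neg]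

lemma gapPotential_eq_sum_cosh :
    gapPotential α x = ∑ i, ∑ j, Real.cosh (α * ((x i : ℝ) - x j)) := by
  have hswap : gapPotential α x = ∑ i, ∑ j, Real.exp (-(α * ((x i : ℝ) - x j))) := by
    rw [gapPotential, Finset.sum_comm]
    simp only [← mul_neg, neg_sub]
  simp only [Real.cosh_eq, ← Finset.sum_div, Finset.sum_add_distrib]
  rw [← hswap, ← gapPotential, add_self_div_two]

/-- Deletions can only shrink the distance of two loads. -/
lemma gapPotential_afterDeletion_le : gapPotential α (afterDeletion x) ≤ gapPotential α x := by
  have hdist (k l : ℕ) : |((k - 1 : ℕ) : ℝ) - (l - 1 : ℕ)| ≤ |(k : ℝ) - l| := by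
    have : |((k - 1 : ℕ) : ℤ) - (l - 1 : ℕ)| ≤ |(k : ℤ) - l| := by grind
    exact_mod_cast this
  simp only [gapPotential_eq_sum_cosh]
  gcongr with i _ j
  rw [Real.cosh_le_cosh, abs_mul, abs_mul]
  exact mul_le_mul_of_nonneg_left (hdist (x i) (x j)) (abs_nonneg α)

lemma integral_gapPotential_step_le_sum_mul_sum [NeZero n] (rule : AllocRule n)
    (lam : unitInterval) :
    ∫ r, gapPotential α (step rule x r) ∂(roundLaw n lam) ≤
      (∑ i, weight α (afterDeletion x) i *
          Real.exp (lam * (Real.exp α - 1) * share rule x i)) *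
        ∑ j, weight (-α) (afterDeletion x) j *
          Real.exp (lam * (Real.exp (-α) - 1) * share rule x j) := by
  have hstep (r : RoundDraws n) (i j : Fin n) :
      Real.exp (α * ((step rule x r i : ℝ) - step rule x r j)) =
        weight α (afterDeletion x) i * weight (-α) (afterDeletion x) j *
          ∏ g, Real.exp (α * (hit rule x (r g) i - hit rule x (r g) j)) := by
    rw [weight_mul_weight_neg, ← Real.exp_sum, ← Finset.mul_sum, Finset.sum_sub_distrib,
      ← Real.exp_add, step_apply, step_apply]
    ring_nf
  calc ∫ r, gapPotential α (step rule x r) ∂(roundLaw n lam)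
      = ∑ i, ∑ j, weight α (afterDeletion x) i * weight (-α) (afterDeletion x) j *
          (∫ d, Real.exp (α * (hit rule x d i - hit rule x d j)) ∂(drawLaw n lam)) ^ n := by
        simp only [gapPotential, hstep]
        rw [integral_finsetSum _ fun i _ => .of_finite]
        refine Finset.sum_congr rfl fun i _ => ?_
        rw [integral_finsetSum _ fun j _ => .of_finite]
        refine Finset.sum_congr rfl fun j _ => ?_
        rw [integral_const_mul, integral_roundLaw_prod n lam fun d =>
          Real.exp (α * (hit rule x d i - hit rule x d j))]
    _ ≤ ∑ i, ∑ j, weight α (afterDeletion x) i * weight (-α) (afterDeletion x) j *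
          (Real.exp (lam * (Real.exp α - 1) * share rule x i) *
            Real.exp (lam * (Real.exp (-α) - 1) * share rule x j)) := by
        gcongr with i _ j
        · exact (mul_pos (weight_pos α _ i) (weight_pos (-α) _ j)).le
        · exact integral_exp_mul_hit_sub_hit_pow_le rule x α lam i j
    _ = _ := by
        rw [Finset.sum_mul_sum]
        refine Finset.sum_congr rfl fun i _ => Finset.sum_congr rfl fun j _ => ?_
        ring

end GapPotential

section ExpEstimates

lemma exp_le_one_add_add_sq {z : ℝ} (hz : |z| ≤ 1) : Real.exp z ≤ 1 + z + z ^ 2 := by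
  linarith [(abs_le.1 (Real.abs_exp_sub_one_sub_id_le hz)).2]

lemma exp_neg_le_one_sub_half {z : ℝ} (hz : 0 ≤ z) (hz1 : z ≤ 1) : Real.exp (-z) ≤ 1 - z / 2 := by
  rw [Real.exp_neg, inv_le_comm₀ (Real.exp_pos z) (by linarith)]
  calc (1 - z / 2)⁻¹ ≤ z + 1 := by
        rw [inv_le_iff_one_le_mul₀ (by linarith)]
        nlinarith
    _ ≤ Real.exp z := Real.add_one_le_exp z

lemma sum_mul_exp_mul_le {ι : Type*} [Fintype ι] {u s : ι → ℝ} {β D M : ℝ} (hu : ∀ i, 0 ≤ u i)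
    (hs : ∀ i, |s i| ≤ M) (hβ : |β| * M ≤ 1) (hD : ∑ i, u i * s i = (∑ i, u i) * D) :
    ∑ i, u i * Real.exp (β * s i) ≤ (∑ i, u i) * Real.exp (β * D + (β * M) ^ 2) := by
  have hexp (i : ι) : Real.exp (β * s i) ≤ 1 + β * s i + (β * M) ^ 2 := by
    have habs : |β * s i| ≤ |β| * M := by
      rw [abs_mul]
      exact mul_le_mul_of_nonneg_left (hs i) (abs_nonneg β)
    calc Real.exp (β * s i) ≤ 1 + β * s i + (β * s i) ^ 2 :=
          exp_le_one_add_add_sq (habs.trans hβ)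
      _ ≤ 1 + β * s i + (|β| * M) ^ 2 := by
          gcongr 1 + β * s i + ?_
          exact sq_le_sq' (abs_le.1 habs).1 (abs_le.1 habs).2
      _ = 1 + β * s i + (β * M) ^ 2 := by rw [mul_pow, sq_abs, mul_pow]
  calc ∑ i, u i * Real.exp (β * s i) ≤ ∑ i, u i * (1 + β * s i + (β * M) ^ 2) :=
        Finset.sum_le_sum fun i _ => mul_le_mul_of_nonneg_left (hexp i) (hu i)
    _ = (∑ i, u i) * (β * D + (β * M) ^ 2 + 1) := by
        simp only [mul_add, mul_one, mul_left_comm _ β, Finset.sum_add_distrib, ← Finset.mul_sum,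
          ← Finset.sum_mul, hD]
        ring
    _ ≤ (∑ i, u i) * Real.exp (β * D + (β * M) ^ 2) :=
        mul_le_mul_of_nonneg_left (Real.add_one_le_exp _) (Finset.sum_nonneg fun i _ => hu i)

lemma exp_sub_one_mul_add_sq_le {l α D : ℝ} (hl : 0 ≤ l) (hl1 : l ≤ 1) (hα : |α| ≤ 1 / 200)
    (hD : |D| ≤ 2) :
    l * (Real.exp α - 1) * D + (l * (Real.exp α - 1) * 2) ^ 2 ≤ l * (α * D + 18 * α ^ 2) := by
  have hlinear : (Real.exp α - 1 - α) * D ≤ α ^ 2 * 2 := by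
    refine (le_abs_self _).trans ?_
    rw [abs_mul]
    gcongr
    exact Real.abs_exp_sub_one_sub_id_le (hα.trans (by norm_num))
  have hquadratic : (Real.exp α - 1) ^ 2 ≤ 2 ^ 2 * α ^ 2 := by
    rw [← sq_abs, ← sq_abs α, ← mul_pow]
    exact pow_le_pow_left₀ (abs_nonneg _)
      (Real.abs_exp_sub_one_le (hα.trans (by norm_num))) 2
  calc l * (Real.exp α - 1) * D + (l * (Real.exp α - 1) * 2) ^ 2
      = l * (α * D + (Real.exp α - 1 - α) * D + l * (4 * (Real.exp α - 1) ^ 2)) := by ring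
    _ ≤ l * (α * D + (Real.exp α - 1 - α) * D + 1 * (4 * (Real.exp α - 1) ^ 2)) := by gcongr
    _ ≤ l * (α * D + 18 * α ^ 2) := by
        refine mul_le_mul_of_nonneg_left ?_ hl
        linarith

end ExpEstimates

section GapDrift

variable [NeZero n] {rule : AllocRule n} {α : ℝ}

lemma IsGreedyTwo.sum_weight_mul_exp_share_le (hrule : IsGreedyTwo rule) (x : Config n)
    (lam : unitInterval) (hα : |α| ≤ 1 / 200) :
    ∑ i, weight α (afterDeletion x) i * Real.exp (lam * (Real.exp α - 1) * share rule x i) ≤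
      (∑ i, weight α (afterDeletion x) i) *
        Real.exp (lam * (α - |α| * gini (weight α (afterDeletion x)) + 18 * α ^ 2)) := by
  have hl : (0 : ℝ) ≤ lam := lam.2.1
  have hl1 : (lam : ℝ) ≤ 1 := lam.2.2
  have hw (i : Fin n) : 0 ≤ weight α (afterDeletion x) i := (weight_pos α _ i).le
  obtain ⟨D, hD, hαD, hD2⟩ : ∃ D, ∑ i, weight α (afterDeletion x) i * share rule x i =
      (∑ i, weight α (afterDeletion x) i) * D ∧
        α * D = α - |α| * gini (weight α (afterDeletion x)) ∧ |D| ≤ 2 := by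
    have hg := gini_nonneg hw
    have hg1 := gini_le_one hw
    rcases le_total 0 α with h | h
    · refine ⟨_, hrule.sum_weight_mul_share_of_nonneg x h, ?_, abs_le.2 ⟨?_, ?_⟩⟩
      · rw [abs_of_nonneg h, mul_sub, mul_one]
      all_goals linarith
    · refine ⟨_, hrule.sum_weight_mul_share_of_nonpos x h, ?_, abs_le.2 ⟨?_, ?_⟩⟩
      · rw [abs_of_nonpos h, mul_add, mul_one, neg_mul, sub_neg_eq_add]
      all_goals linarith
  have hshare (i : Fin n) : |share rule x i| ≤ 2 := by
    rw [abs_of_nonneg (share_nonneg rule x i)]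
    exact hrule.share_le_two x i
  have hsmall : |lam * (Real.exp α - 1)| * 2 ≤ 1 := by
    rw [abs_mul, abs_of_nonneg hl]
    nlinarith [abs_nonneg (Real.exp α - 1), Real.abs_exp_sub_one_le (hα.trans (by norm_num))]
  refine (sum_mul_exp_mul_le hw hshare hsmall hD).trans ?_
  rw [← hαD]
  gcongr
  · exact Finset.sum_nonneg fun i _ => hw i
  · exact exp_sub_one_mul_add_sq_le hl hl1 hα hD2

lemma IsGreedyTwo.integral_gapPotential_step_le_mul_exp (hrule : IsGreedyTwo rule)
    (lam : unitInterval) (hα : 0 ≤ α) (hα1 : α ≤ 1 / 200) (x : Config n) :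
    ∫ r, gapPotential α (step rule x r) ∂(roundLaw n lam) ≤
      gapPotential α (afterDeletion x) * Real.exp (lam * (36 * α ^ 2 - α *
        (gini (weight α (afterDeletion x)) + gini (weight (-α) (afterDeletion x))))) := by
  have habs : |α| = α := abs_of_nonneg hα
  calc ∫ r, gapPotential α (step rule x r) ∂(roundLaw n lam)
      ≤ _ := integral_gapPotential_step_le_sum_mul_sum α x rule lam
    _ ≤ (∑ i, weight α (afterDeletion x) i) *
            Real.exp (lam * (α - |α| * gini (weight α (afterDeletion x)) + 18 * α ^ 2)) *
          ((∑ i, weight (-α) (afterDeletion x) i) * Real.exp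
            (lam * (-α - |-α| * gini (weight (-α) (afterDeletion x)) + 18 * (-α) ^ 2))) :=
        mul_le_mul (hrule.sum_weight_mul_exp_share_le x lam (by rwa [habs]))
          (hrule.sum_weight_mul_exp_share_le x lam (by rwa [abs_neg, habs]))
          (Finset.sum_nonneg fun j _ => mul_nonneg (weight_pos (-α) _ j).le (Real.exp_pos _).le)
          (mul_nonneg (sum_weight_pos α _).le (Real.exp_pos _).le)
    _ = _ := by
        rw [gapPotential_eq_sum_weight_mul_sum_weight_neg, mul_mul_mul_comm, ← Real.exp_add,
          abs_neg, habs]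
        ring_nf

/-- Unbalanced weights have large Gini coefficients, which make the gap potential drop; for
balanced weights `one_sub_gini_mul_sum_mul_sum_inv_le` bounds the gap potential itself. -/
lemma IsGreedyTwo.integral_gapPotential_step_le (hrule : IsGreedyTwo rule) (lam : unitInterval)
    (hα : 0 ≤ α) (hα1 : α ≤ 1 / 200) (x : Config n) :
    ∫ r, gapPotential α (step rule x r) ∂(roundLaw n lam) ≤
      (1 - lam * α / 4) * gapPotential α x + lam * α / 2 * n ^ 2 := by
  have hl1 : (lam : ℝ) ≤ 1 := lam.2.2
  have hlα : 0 ≤ lam * α := mul_nonneg lam.2.1 hα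
  have hlα1 : lam * α ≤ 1 / 200 := by nlinarith
  have hP (i : Fin n) := weight_pos α (afterDeletion x) i
  have hQ (i : Fin n) := (weight_pos (-α) (afterDeletion x) i).le
  have hΦ := gapPotential_nonneg α (afterDeletion x)
  have hstep := hrule.integral_gapPotential_step_le_mul_exp lam hα hα1 x
  have hbalanced := one_sub_gini_mul_sum_mul_sum_inv_le hP
  rw [← weight_neg, ← gapPotential_eq_sum_weight_mul_sum_weight_neg, Fintype.card_fin]
    at hbalanced
  have hG0 := add_nonneg (gini_nonneg fun i => (hP i).le) (gini_nonneg hQ)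
  have hG2 := add_le_add (gini_le_one fun i => (hP i).le) (gini_le_one hQ)
  set G := gini (weight α (afterDeletion x)) + gini (weight (-α) (afterDeletion x))
  have hexp : Real.exp (lam * (36 * α ^ 2 - α * G)) ≤ 1 + lam * α * (1 / 4 - G) := by
    have habs : |lam * (36 * α ^ 2 - α * G)| ≤ lam * α * (11 / 5) := by
      rw [abs_le]
      constructor <;> nlinarith
    refine (exp_le_one_add_add_sq (habs.trans (by nlinarith))).trans ?_
    have hsq := sq_le_sq' (abs_le.1 habs).1 (abs_le.1 habs).2
    linarith [mul_le_mul_of_nonneg_left hα1 hlα, mul_le_mul_of_nonneg_left hlα1 hlα]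
  calc ∫ r, gapPotential α (step rule x r) ∂(roundLaw n lam)
      ≤ gapPotential α (afterDeletion x) * (1 + lam * α * (1 / 4 - G)) :=
        hstep.trans (mul_le_mul_of_nonneg_left hexp hΦ)
    _ ≤ (1 - lam * α / 4) * gapPotential α (afterDeletion x) + lam * α / 2 * n ^ 2 := by
        linarith [mul_le_mul_of_nonneg_left hbalanced hlα]
    _ ≤ (1 - lam * α / 4) * gapPotential α x + lam * α / 2 * n ^ 2 := by
        gcongr
        · nlinarith
        · exact gapPotential_afterDeletion_le α x

lemma IsGreedyTwo.integral_gapPotential_load_le (hrule : IsGreedyTwo rule) (lam : unitInterval)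
    (hα : 0 ≤ α) (hα1 : α ≤ 1 / 200) (t : ℕ) :
    ∫ ω, gapPotential α (load rule ω t) ∂(processLaw n lam) ≤ 2 * n ^ 2 := by
  have hlα1 : lam * α ≤ 1 := mul_le_one₀ lam.2.2 hα (by linarith)
  simp only [load_eq_trajectory]
  refine integral_comp_trajectory_le_of_drift (roundLaw n lam) (step rule) (fun _ => 0)
    (a := 1 - lam * α / 4) (by linarith)
    (hrule.integral_gapPotential_step_le lam hα hα1) (u := lam * α / 2 * n ^ 2)
    (fun _ => by simp) ?_ (by linarith) t
  rw [gapPotential_zero]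
  linarith [sq_nonneg (n : ℝ)]

end GapDrift

section MeanPotential

/-- The mean load of the bins. -/
noncomputable def meanLoad (x : Config n) : ℝ := (∑ i, (x i : ℝ)) / n

/-- The potential that controls the mean load, hence the total number of balls. -/
noncomputable def meanPotential (α : ℝ) (x : Config n) : ℝ := Real.exp (α * meanLoad x)

lemma meanPotential_pos (α : ℝ) (x : Config n) : 0 < meanPotential α x := Real.exp_pos _

lemma meanLoad_afterDeletion_le (x : Config n) : meanLoad (afterDeletion x) ≤ meanLoad x := by
  unfold meanLoad afterDeletion
  gcongr
  exact Nat.sub_le _ _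

lemma meanLoad_step (rule : AllocRule n) (x : Config n) (r : RoundDraws n) :
    meanLoad (step rule x r) =
      meanLoad (afterDeletion x) + ∑ g, (if (r g).1 = true then 1 else 0 : ℝ) / n := by
  have hhit (d : Draw n) : ∑ i, hit rule x d i = if d.1 = true then 1 else 0 := by
    by_cases h : d.1 = true <;> simp [hit, h]
  simp only [meanLoad, step_apply, Finset.sum_add_distrib, add_div]
  rw [Finset.sum_comm]
  simp only [hhit, Finset.sum_div]

variable [NeZero n]

lemma sum_eq_sum_const_meanLoad (x : Config n) : ∑ i, (x i : ℝ) = ∑ _i : Fin n, meanLoad x := by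
  rw [Finset.sum_const, Finset.card_univ, Fintype.card_fin, nsmul_eq_mul, meanLoad,
    mul_div_cancel₀ _ (Nat.cast_ne_zero.2 (NeZero.ne n))]

lemma exists_le_meanLoad (x : Config n) : ∃ i, (x i : ℝ) ≤ meanLoad x := by
  obtain ⟨i, -, hi⟩ :=
    Finset.exists_le_of_sum_le Finset.univ_nonempty (sum_eq_sum_const_meanLoad x).le
  exact ⟨i, hi⟩

lemma exists_meanLoad_le (x : Config n) : ∃ i, meanLoad x ≤ x i := by
  obtain ⟨i, -, hi⟩ :=
    Finset.exists_le_of_sum_le Finset.univ_nonempty (sum_eq_sum_const_meanLoad x).ge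
  exact ⟨i, hi⟩

lemma meanLoad_afterDeletion {x : Config n} (hx : ∀ i, x i ≠ 0) :
    meanLoad (afterDeletion x) = meanLoad x - 1 := by
  have hsub (i : Fin n) : ((x i - 1 : ℕ) : ℝ) = x i - 1 :=
    Nat.cast_pred (Nat.pos_of_ne_zero (hx i))
  have hn : (n : ℝ) ≠ 0 := Nat.cast_ne_zero.2 (NeZero.ne n)
  simp only [meanLoad, afterDeletion, hsub, Finset.sum_sub_distrib]
  simp [sub_div, hn]

lemma integral_meanPotential_step (rule : AllocRule n) (lam : unitInterval) (α : ℝ)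
    (x : Config n) :
    ∫ r, meanPotential α (step rule x r) ∂(roundLaw n lam) =
      meanPotential α (afterDeletion x) * (lam * Real.exp (α / n) + (1 - lam)) ^ n := by
  have hn : (n : ℝ) ≠ 0 := Nat.cast_ne_zero.2 (NeZero.ne n)
  have hstep (r : RoundDraws n) : meanPotential α (step rule x r) =
      meanPotential α (afterDeletion x) *
        ∏ g, Real.exp (α * ((if (r g).1 = true then 1 else 0 : ℝ) / n)) := by
    rw [meanPotential, meanLoad_step, meanPotential, ← Real.exp_sum, ← Finset.mul_sum,
      ← Real.exp_add, mul_add]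
  simp only [hstep]
  rw [integral_const_mul, integral_roundLaw_prod n lam fun d =>
    Real.exp (α * ((if d.1 = true then 1 else 0 : ℝ) / n)), integral_drawLaw]
  congr 2
  simp only [Bool.false_eq_true, if_true, if_false, zero_div, mul_zero, Real.exp_zero, mul_one,
    Finset.sum_const, Finset.card_univ, Fintype.card_fin, nsmul_eq_mul, mul_one_div]
  field_simp

lemma integral_meanPotential_step_le_of_exists_eq_zero (rule : AllocRule n) (lam : unitInterval)
    {α : ℝ} (hα : 0 ≤ α) (hα1 : α ≤ 1 / 2) {x : Config n} (hx : ∃ j, x j = 0) :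
    ∫ r, meanPotential α (step rule x r) ∂(roundLaw n lam) ≤ 3 * gapPotential α x := by
  have hl : (0 : ℝ) ≤ lam := lam.2.1
  have hl1 : (lam : ℝ) ≤ 1 := lam.2.2
  have hn : (n : ℝ) ≠ 0 := Nat.cast_ne_zero.2 (NeZero.ne n)
  have hmean : meanPotential α (afterDeletion x) ≤ gapPotential α x := by
    obtain ⟨j, hj⟩ := hx
    obtain ⟨i, hi⟩ := exists_meanLoad_le x
    refine le_trans (Real.exp_le_exp.2 ?_) (exp_mul_sub_le_gapPotential α x i j)
    rw [hj, Nat.cast_zero, sub_zero]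
    exact mul_le_mul_of_nonneg_left ((meanLoad_afterDeletion_le x).trans hi) hα
  have hfactor : (lam * Real.exp (α / n) + (1 - lam)) ^ n ≤ 3 := by
    have hexp : 1 ≤ Real.exp (α / n) := Real.one_le_exp (by positivity)
    calc (lam * Real.exp (α / n) + (1 - lam)) ^ n ≤ Real.exp (α / n) ^ n := by
          gcongr
          nlinarith
      _ = Real.exp α := by rw [← Real.exp_nat_mul, mul_div_cancel₀ _ hn]
      _ ≤ Real.exp 1 := Real.exp_le_exp.2 (by linarith)
      _ ≤ 3 := by linarith [Real.exp_one_lt_d9]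
  rw [integral_meanPotential_step, mul_comm]
  exact mul_le_mul hfactor hmean (meanPotential_pos α _).le (by norm_num)

lemma add_mul_exp_neg_div_le {n l α : ℝ} (hn : 1 ≤ n) (hl : l ≤ 1) (hα : 0 ≤ α) (hα1 : α ≤ 1) :
    l + (1 - l) * Real.exp (-(α / n)) ≤ Real.exp (-((1 - l) * α / 2 / n)) := by
  have hhalf := exp_neg_le_one_sub_half (z := α / n) (by positivity)
    (div_le_one_of_le₀ (hα1.trans hn) (by positivity))
  calc l + (1 - l) * Real.exp (-(α / n)) ≤ l + (1 - l) * (1 - α / n / 2) := by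
        linarith [mul_le_mul_of_nonneg_left hhalf (sub_nonneg.2 hl)]
    _ = -((1 - l) * α / 2 / n) + 1 := by ring
    _ ≤ Real.exp (-((1 - l) * α / 2 / n)) := Real.add_one_le_exp _

lemma integral_meanPotential_step_le_of_forall_ne_zero (rule : AllocRule n) (lam : unitInterval)
    {α : ℝ} (hα : 0 ≤ α) (hα1 : α ≤ 1) {x : Config n} (hx : ∀ i, x i ≠ 0) :
    ∫ r, meanPotential α (step rule x r) ∂(roundLaw n lam) ≤
      (1 - (1 - lam) * α / 4) * meanPotential α x := by
  have hl : (0 : ℝ) ≤ lam := lam.2.1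
  have hl1 : (0 : ℝ) ≤ 1 - lam := sub_nonneg.2 lam.2.2
  have hn : (1 : ℝ) ≤ n := Nat.one_le_cast.2 (NeZero.pos n)
  have hn0 : (n : ℝ) ≠ 0 := by positivity
  set z : ℝ := (1 - lam) * α / 2 with hz
  have hz0 : 0 ≤ z := by positivity
  calc ∫ r, meanPotential α (step rule x r) ∂(roundLaw n lam)
      = meanPotential α x * (Real.exp (-α) * (lam * Real.exp (α / n) + (1 - lam)) ^ n) := by
        rw [integral_meanPotential_step, meanPotential, meanLoad_afterDeletion hx, mul_sub,
          mul_one, sub_eq_add_neg, Real.exp_add, mul_assoc, meanPotential]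
    _ = meanPotential α x * (lam + (1 - lam) * Real.exp (-(α / n))) ^ n := by
        have hα' : Real.exp (-α) = Real.exp (-(α / n)) ^ n := by
          rw [← Real.exp_nat_mul, mul_neg, mul_div_cancel₀ _ hn0]
        rw [hα', ← mul_pow, mul_add, mul_left_comm, ← Real.exp_add, neg_add_cancel, Real.exp_zero,
          mul_one, mul_comm (Real.exp _)]
    _ ≤ meanPotential α x * Real.exp (-(z / n)) ^ n := by
        gcongr
        · exact (meanPotential_pos α x).le
        · exact add_mul_exp_neg_div_le hn lam.2.2 hα hα1
    _ = meanPotential α x * Real.exp (-z) := by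
        rw [← Real.exp_nat_mul, mul_neg, mul_div_cancel₀ _ hn0]
    _ ≤ meanPotential α x * (1 - z / 2) := by
        gcongr
        · exact (meanPotential_pos α x).le
        · exact exp_neg_le_one_sub_half hz0 (by rw [hz]; nlinarith)
    _ = (1 - (1 - lam) * α / 4) * meanPotential α x := by
        rw [hz]
        ring

/-- If no bin is empty, then all `n` bins delete a ball, while only `lam * n` new ones are expected;
if some bin is empty, then the mean load is at most the largest gap. -/
lemma integral_meanPotential_step_le (rule : AllocRule n) (lam : unitInterval) {α : ℝ}
    (hα : 0 ≤ α) (hα1 : α ≤ 1 / 2) (x : Config n) :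
    ∫ r, meanPotential α (step rule x r) ∂(roundLaw n lam) ≤
      (1 - (1 - lam) * α / 4) * meanPotential α x + 3 * gapPotential α x := by
  have hcontract : 0 ≤ 1 - (1 - lam) * α / 4 := by nlinarith [lam.2.1, lam.2.2]
  by_cases hx : ∃ j, x j = 0
  · exact (integral_meanPotential_step_le_of_exists_eq_zero rule lam hα hα1 hx).trans
      (le_add_of_nonneg_left (mul_nonneg hcontract (meanPotential_pos α x).le))
  · push Not at hx
    exact (integral_meanPotential_step_le_of_forall_ne_zero rule lam hα (by linarith) hx).trans
      (le_add_of_nonneg_right (mul_nonneg (by norm_num) (gapPotential_nonneg α x)))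

lemma IsGreedyTwo.integral_meanPotential_load_le {rule : AllocRule n} (hrule : IsGreedyTwo rule)
    {lam : unitInterval} (hlam : (lam : ℝ) < 1) {α : ℝ} (hα : 0 < α) (hα1 : α ≤ 1 / 200)
    (t : ℕ) :
    ∫ ω, meanPotential α (load rule ω t) ∂(processLaw n lam) ≤
      24 * n ^ 2 / ((1 - lam) * α) := by
  have hl : 0 < 1 - (lam : ℝ) := sub_pos.2 hlam
  have hl1 : 1 - (lam : ℝ) ≤ 1 := sub_le_self _ lam.2.1
  have hn : (1 : ℝ) ≤ n := Nat.one_le_cast.2 (NeZero.pos n)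
  have hgap (t : ℕ) : ∫ ω, 3 * gapPotential α (load rule ω t) ∂(processLaw n lam) ≤
      6 * n ^ 2 := by
    rw [integral_const_mul]
    linarith [hrule.integral_gapPotential_load_le lam hα.le hα1 t]
  simp only [load_eq_trajectory] at hgap ⊢
  refine integral_comp_trajectory_le_of_drift (roundLaw n lam) (step rule) (fun _ => 0)
    (a := 1 - (1 - lam) * α / 4) (by nlinarith)
    (integral_meanPotential_step_le rule lam hα.le (by linarith)) hgap ?_ (le_of_eq ?_) t
  · rw [le_div_iff₀ (by positivity)]
    simp only [meanPotential, meanLoad, Nat.cast_zero, Finset.sum_const_zero, zero_div, mul_zero,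
      Real.exp_zero, one_mul]
    nlinarith
  · field_simp
    ring

end MeanPotential

section Tail

variable [NeZero n]

lemma exp_mul_maxLoad_le (x : Config n) {α : ℝ} (hα : 0 ≤ α) :
    Real.exp (α * maxLoad x) ≤ gapPotential α x * meanPotential α x := by
  obtain ⟨i, -, hi⟩ := Finset.exists_mem_eq_sup Finset.univ Finset.univ_nonempty x
  obtain ⟨j, hj⟩ := exists_le_meanLoad x
  calc Real.exp (α * maxLoad x) = Real.exp (α * ((x i : ℝ) - x j)) * Real.exp (α * x j) := by
        rw [maxLoad, hi, ← Real.exp_add]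
        ring_nf
    _ ≤ gapPotential α x * meanPotential α x := by
        gcongr
        · exact gapPotential_nonneg α x
        · exact exp_mul_sub_le_gapPotential α x i j
        · exact Real.exp_le_exp.2 (mul_le_mul_of_nonneg_left hj hα)

lemma exp_half_mul_maxLoad_le (x : Config n) {α : ℝ} (hα : 0 ≤ α) :
    Real.exp (α * maxLoad x / 2) ≤ (gapPotential α x + meanPotential α x) / 2 := by
  have hΦ := gapPotential_nonneg α x
  have hW := (meanPotential_pos α x).le
  have hsq : Real.exp (α * maxLoad x / 2) ^ 2 ≤
      ((gapPotential α x + meanPotential α x) / 2) ^ 2 := by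
    calc Real.exp (α * maxLoad x / 2) ^ 2 = Real.exp (α * maxLoad x) := by
          rw [← Real.exp_nat_mul, Nat.cast_ofNat, mul_div_cancel₀ _ two_ne_zero]
      _ ≤ gapPotential α x * meanPotential α x := exp_mul_maxLoad_le x hα
      _ ≤ ((gapPotential α x + meanPotential α x) / 2) ^ 2 := by
          linarith [sq_nonneg (gapPotential α x - meanPotential α x)]
  exact le_of_sq_le_sq hsq (by positivity)

lemma IsGreedyTwo.integral_exp_half_mul_maxLoad_le {rule : AllocRule n}
    (hrule : IsGreedyTwo rule) {lam : unitInterval} (hlam : (lam : ℝ) < 1) {α : ℝ} (hα : 0 < α)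
    (hα1 : α ≤ 1 / 200) (t : ℕ) :
    ∫ ω, Real.exp (α * maxLoad (load rule ω t) / 2) ∂(processLaw n lam) ≤
      13 * n ^ 2 / ((1 - lam) * α) := by
  have hl : 0 < 1 - (lam : ℝ) := sub_pos.2 hlam
  have hint (V : Config n → ℝ) := integrable_comp_load rule lam V t
  calc ∫ ω, Real.exp (α * maxLoad (load rule ω t) / 2) ∂(processLaw n lam)
      ≤ ∫ ω, (gapPotential α (load rule ω t) + meanPotential α (load rule ω t)) / 2
          ∂(processLaw n lam) :=
        integral_mono (hint fun x => Real.exp (α * maxLoad x / 2))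
          (hint fun x => (gapPotential α x + meanPotential α x) / 2)
          fun ω => exp_half_mul_maxLoad_le _ hα.le
    _ = (∫ ω, gapPotential α (load rule ω t) ∂(processLaw n lam) +
          ∫ ω, meanPotential α (load rule ω t) ∂(processLaw n lam)) / 2 := by
        rw [integral_div, integral_add (hint _) (hint _)]
    _ ≤ (2 * n ^ 2 + 24 * n ^ 2 / ((1 - lam) * α)) / 2 := by
        gcongr
        · exact hrule.integral_gapPotential_load_le lam hα.le hα1 t
        · exact hrule.integral_meanPotential_load_le hlam hα hα1 t
    _ ≤ 13 * n ^ 2 / ((1 - lam) * α) := by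
        have hsmall : (1 - lam) * α ≤ 1 := by nlinarith [lam.2.1]
        have : (n : ℝ) ^ 2 ≤ n ^ 2 / ((1 - lam) * α) :=
          le_div_self (by positivity) (by positivity) hsmall
        linarith [mul_div_assoc (24 : ℝ) (n ^ 2) ((1 - lam) * α),
          mul_div_assoc (13 : ℝ) (n ^ 2) ((1 - lam) * α)]

lemma IsGreedyTwo.measureReal_lt_maxLoad_le {rule : AllocRule n} (hrule : IsGreedyTwo rule)
    {lam : unitInterval} (hlam : (lam : ℝ) < 1) {α : ℝ} (hα : 0 < α) (hα1 : α ≤ 1 / 200)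
    (t : ℕ) (s : ℝ) :
    (processLaw n lam).real {ω | s < maxLoad (load rule ω t)} ≤
      13 * n ^ 2 / ((1 - lam) * α) * Real.exp (-(α * s / 2)) := by
  rw [Real.exp_neg, ← div_eq_mul_inv, le_div_iff₀ (Real.exp_pos _), mul_comm]
  refine le_trans ?_ (hrule.integral_exp_half_mul_maxLoad_le hlam hα hα1 t)
  refine le_trans ?_ (mul_meas_ge_le_integral_of_nonneg (.of_forall fun ω => (Real.exp_pos _).le)
    (integrable_comp_load rule lam (fun x => Real.exp (α * maxLoad x / 2)) t)
    (Real.exp (α * s / 2)))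
  refine mul_le_mul_of_nonneg_left (measureReal_mono fun ω hω => ?_) (Real.exp_pos _).le
  have hω : s < maxLoad (load rule ω t) := hω
  exact Real.exp_le_exp.2 (by gcongr)

lemma IsGreedyTwo.measureReal_mul_log_lt_maxLoad_le {rule : AllocRule n} (hrule : IsGreedyTwo rule)
    {lam : unitInterval} (hlam : (lam : ℝ) < 1) (hn : 2 ≤ n) {c : ℝ} (hc : 0 ≤ c) (t : ℕ) :
    (processLaw n lam).real
        {ω | 400 * (c + 14) * Real.log (n / (1 - lam)) < maxLoad (load rule ω t)} ≤
      (n : ℝ) ^ (-c) := by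
  have hl : 0 < 1 - (lam : ℝ) := sub_pos.2 hlam
  have hl1 : 1 - (lam : ℝ) ≤ 1 := sub_le_self _ lam.2.1
  have hn2 : (2 : ℝ) ≤ n := Nat.ofNat_le_cast.2 hn
  set N : ℝ := n / (1 - lam) with hN
  have hnN : (n : ℝ) ≤ N := le_div_self (by positivity) hl hl1
  have hN0 : 0 < N := by linarith
  have hexp : Real.exp (-(1 / 200 * (400 * (c + 14) * Real.log N) / 2)) = N ^ (-c) / N ^ 14 := by
    rw [← Real.rpow_natCast, ← Real.rpow_sub hN0, Real.rpow_def_of_pos hN0]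
    push_cast
    ring_nf
  have hpoly : 13 * (n : ℝ) ^ 2 / ((1 - lam) * (1 / 200)) ≤ N ^ 14 := by
    calc 13 * (n : ℝ) ^ 2 / ((1 - lam) * (1 / 200)) = 2600 * (n * N) := by
          rw [hN]
          field_simp
          norm_num
      _ ≤ 2 ^ 12 * (N * N) := by gcongr; norm_num
      _ ≤ N ^ 12 * (N * N) := by gcongr; exact hn2.trans hnN
      _ = N ^ 14 := by ring
  calc _ ≤ 13 * (n : ℝ) ^ 2 / ((1 - lam) * (1 / 200)) *
          Real.exp (-(1 / 200 * (400 * (c + 14) * Real.log N) / 2)) :=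
        hrule.measureReal_lt_maxLoad_le hlam (by norm_num) le_rfl t _
    _ ≤ N ^ 14 * (N ^ (-c) / N ^ 14) := by
        rw [hexp]
        gcongr
    _ = N ^ (-c) := mul_div_cancel₀ _ (by positivity)
    _ ≤ (n : ℝ) ^ (-c) := Real.rpow_le_rpow_of_nonpos (by positivity) hnN (neg_nonpos.2 hc)

end Tail

end TwoChoice

theorem mainTheorem1_general {c : ℝ} (hc : 0 < c) :
    ∃ C : ℝ, 0 < C ∧
      ∀ n : ℕ, 1 ≤ n →
      ∀ lam : unitInterval, (lam : ℝ) < 1 →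
      ∀ rule : TwoChoice.AllocRule n, TwoChoice.IsGreedyTwo rule →
      ∀ t : ℕ,
        1 - (n : ℝ) ^ (-c) ≤
          (TwoChoice.processLaw n lam).real
            {ω | (TwoChoice.maxLoad (TwoChoice.load rule ω t) : ℝ) ≤
              C * Real.log ((n : ℝ) / (1 - (lam : ℝ)))} := by
  refine ⟨400 * (c + 14), by positivity, fun n hn lam hlam rule hrule t => ?_⟩
  have : NeZero n := ⟨by omega⟩
  rcases hn.eq_or_lt with rfl | hn
  · simp
  set A := {ω | (TwoChoice.maxLoad (TwoChoice.load rule ω t) : ℝ) ≤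
    400 * (c + 14) * Real.log (n / (1 - lam))}
  have htail := hrule.measureReal_mul_log_lt_maxLoad_le hlam hn hc.le t
  simp only [← not_le] at htail
  have hcompl : 1 ≤ (TwoChoice.processLaw n lam).real A +
      (TwoChoice.processLaw n lam).real Aᶜ := by
    simpa using measureReal_union_le (μ := TwoChoice.processLaw n lam) A Aᶜ
  linarith [show (TwoChoice.processLaw n lam).real Aᶜ ≤ (n : ℝ) ^ (-c) from htail]

theorem mainTheorem1 :
    ∃ (C c : ℝ) (n₀ : ℕ), 0 < C ∧ 0 < c ∧
      ∀ n : ℕ, n₀ ≤ n → 1 ≤ n →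
      ∀ lam : unitInterval, 1 / 4 ≤ (lam : ℝ) → (lam : ℝ) < 1 →
      ∀ rule : TwoChoice.AllocRule n, TwoChoice.IsGreedyTwo rule →
      ∀ t : ℕ,
        1 - (n : ℝ) ^ (-c) ≤
          (TwoChoice.processLaw n lam).real
            {ω | (TwoChoice.maxLoad (TwoChoice.load rule ω t) : ℝ) ≤
              C * Real.log ((n : ℝ) / (1 - (lam : ℝ)))} := by
  obtain ⟨C, hC, hload⟩ := mainTheorem1_general one_pos
  exact ⟨C, 1, 0, hC, one_pos, fun n _ hn lam _ hlam => hload n hn lam hlam⟩
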